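/- Let $W$ be a finite Coxeter group with finite set of simple reflections $\{s_i\}_{i\in I}$ and Coxeter matrix $(m(i,j))_{i,j\in I}$. Its 0-Hecke monoid $H_0(W)$ is generated by $\pi_i$ $(i\in I)$ with relations $\pi_i^2=\pi_i$ and $\pi_i\pi_j\pi_i\cdots=\pi_j\pi_i\pi_j\cdots$ ($m(i,j)$ factors on each side). For $J\subseteq I$ let $\pi_J$ be the longest element of the submonoid generated by $\{\pi_j \mid j\in J\}$. For a finite $\mathcal J$-trivial monoid $M$ (that is, the preorder $x\le_{\mathcal J}y \iff x\in MyM$ is antisymmetric) and $x\in M$, let $\mathrm{lfix}(x)$ (resp. $\mathrm{rfix}(x)$) be the $\le_{\mathcal J}$-least idempotent $e$ with $ex=x$ (resp. $xe=x$). A factorization $x=uv$ is non-trivial if $\mathrm{lfix}(x)\,u\ne\mathrm{lfix}(x)$ and $v\,\mathrm{rfix}(x)\neq\mathrm{rfix}(x)$. The set $Q(M)$ of quiver elements consists of the non-idempotent $x\in M$ that admit no non-trivial factorization; $x\in Q(M)$ labels an arrow of the quiver of $M$ from the vertex $\mathrm{lfix}(x)$ to the vertex $\mathrm{rfix}(x)$.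 Then $H_0(W)$ is finite and $\mathcal J$-trivial, every $\pi_J$ is well defined (the longest element exists and is unique), and the elements of $Q(H_0(W))$ are exactly the products $\pi_J\pi_K$, where $J,K\subseteq I$ are incomparable for inclusion and, for all $j\in J\setminus K$ and $k\in K\setminus J$, the generators $\pi_j$ and $\pi_k$ do not commute. Moreover, for each such pair $(J,K)$ one has $\mathrm{lfix}(\pi_J\pi_K)=\pi_J$ and $\mathrm{rfix}(\pi_J\pi_K)=\pi_K$, and distinct such pairs give distinct elements $\pi_J\pi_K$; so the arrows of the quiver are labelled by these pairs, the arrow $\pi_J\pi_K$ going from $\pi_J$ to $\pi_K$. -/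

import Mathlib

section GreenAndSymbols

variable {S : Type*} [Monoid S]

/-- Green's preorder `x ≤_J y`: `x = u y v` for some `u, v`. -/
def GreenJLE (x y : S) : Prop := ∃ u v : S, x = u * y * v

variable (S) in
/-- All `J`-classes are singletons, i.e. `≤_J` is antisymmetric. -/
def IsJTrivialMonoid : Prop := ∀ x y : S, GreenJLE x y → GreenJLE y x → x = y

/-- `e` is the `≤_J`-least idempotent fixing `x` on the left. -/
def IsLeftSymbol (x e : S) : Prop :=
  IsIdempotentElem e ∧ e * x = x ∧
    ∀ g : S, IsIdempotentElem g → g * x = x → GreenJLE e g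

/-- `f` is the `≤_J`-least idempotent fixing `x` on the right. -/
def IsRightSymbol (x f : S) : Prop :=
  IsIdempotentElem f ∧ x * f = x ∧
    ∀ g : S, IsIdempotentElem g → x * g = x → GreenJLE f g

theorem GreenJLE.trans {x y z : S} (h : GreenJLE x y) (h' : GreenJLE y z) : GreenJLE x z := by
  obtain ⟨u, v, rfl⟩ := h
  obtain ⟨u', v', rfl⟩ := h'
  exact ⟨u * u', v' * v, by simp only [mul_assoc]⟩

theorem greenJLE_exists_minimal [Finite S] (T : Set S) (hT : T.Nonempty) :
    ∃ r ∈ T, ∀ s ∈ T, GreenJLE s r → GreenJLE r s := by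
  let R : S → S → Prop := fun a b => GreenJLE a b ∧ ¬ GreenJLE b a
  have : IsTrans S R := ⟨fun a b c hab hbc =>
    ⟨hab.1.trans hbc.1, fun hca => hab.2 (hbc.1.trans hca)⟩⟩
  have : Std.Irrefl R := ⟨fun a ha => ha.2 ha.1⟩
  obtain ⟨r, hr, hmin⟩ := (Finite.wellFounded_of_trans_of_irrefl R).has_min T hT
  exact ⟨r, hr, fun s hs hsr => by_contra fun hn => hmin s hs ⟨hsr, hn⟩⟩

/-- In a finite `J`-trivial monoid every element has exactly one left symbol. -/
theorem existsUnique_isLeftSymbol [Finite S] (hS : IsJTrivialMonoid S) (x : S) :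
    ∃! e : S, IsLeftSymbol x e := by
  obtain ⟨r, hr, hmin⟩ := greenJLE_exists_minimal {u : S | u * x = x} ⟨1, one_mul x⟩
  have key : ∀ u : S, u * x = x → r * u = r := by
    intro u hu
    have h1 : GreenJLE (r * u) r := ⟨1, u, by simp⟩
    have h2 : r * u * x = x := by rw [mul_assoc, hu]; exact hr
    exact hS _ _ h1 (hmin _ h2 h1)
  have hrS : IsLeftSymbol x r :=
    ⟨key r hr, hr, fun g _ hg => ⟨r, 1, by simp [key g hg]⟩⟩
  exact ⟨r, hrS, fun e he => hS _ _ (he.2.2 r hrS.1 hr) (hrS.2.2 e he.1 he.2.1)⟩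

/-- In a finite `J`-trivial monoid every element has exactly one right symbol. -/
theorem existsUnique_isRightSymbol [Finite S] (hS : IsJTrivialMonoid S) (x : S) :
    ∃! f : S, IsRightSymbol x f := by
  obtain ⟨r, hr, hmin⟩ := greenJLE_exists_minimal {u : S | x * u = x} ⟨1, mul_one x⟩
  have key : ∀ u : S, x * u = x → u * r = r := by
    intro u hu
    have h1 : GreenJLE (u * r) r := ⟨u, 1, by simp⟩
    have h2 : x * (u * r) = x := by rw [← mul_assoc, hu]; exact hr
    exact hS _ _ h1 (hmin _ h2 h1)
  have hrS : IsRightSymbol x r :=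
    ⟨key r hr, hr, fun g _ hg => ⟨1, r, by simp [key g hg]⟩⟩
  exact ⟨r, hrS, fun e he => hS _ _ (he.2.2 r hrS.1 hr) (hrS.2.2 e he.1 he.2.1)⟩

/-- The left symbol `lfix(x)`; it exists and is unique in a finite `J`-trivial monoid. -/
noncomputable def lfix (x : S) : S := Classical.epsilon (IsLeftSymbol x)

/-- The right symbol `rfix(x)`; it exists and is unique in a finite `J`-trivial monoid. -/
noncomputable def rfix (x : S) : S := Classical.epsilon (IsRightSymbol x)

theorem isLeftSymbol_lfix [Finite S] (hS : IsJTrivialMonoid S) (x : S) :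
    IsLeftSymbol x (lfix x) :=
  Classical.epsilon_spec (existsUnique_isLeftSymbol hS x).exists

theorem isRightSymbol_rfix [Finite S] (hS : IsJTrivialMonoid S) (x : S) :
    IsRightSymbol x (rfix x) :=
  Classical.epsilon_spec (existsUnique_isRightSymbol hS x).exists

/-- The factorization `x = u v` is non-trivial: `e u ≠ e` and `v f ≠ f` for `e = lfix(x)`,
`f = rfix(x)`. -/
def IsNontrivialFactorization (x u v : S) : Prop :=
  x = u * v ∧ lfix x * u ≠ lfix x ∧ v * rfix x ≠ rfix x

/-- `x` is c-irreducible: it admits no non-trivial factorization. -/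
def IsCIrreducible (x : S) : Prop := ∀ u v : S, ¬ IsNontrivialFactorization x u v

variable (S) in
/-- The set of quiver elements: the c-irreducible non-idempotent elements. -/
def quiverElements : Set S := {x | IsCIrreducible x ∧ ¬ IsIdempotentElem x}

end GreenAndSymbols

section ZeroHecke

variable {I : Type*}

/-- The alternating word `i j i j ⋯` with `n` letters. -/
def altWord : I → I → ℕ → FreeMonoid I
  | _, _, 0 => 1
  | i, j, n + 1 => FreeMonoid.of i * altWord j i n

/-- The defining relations of the 0-Hecke monoid. As in Mathlib's `CoxeterMatrix`, the entry `0`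
stands for `m(i, j) = ∞`; the relation is then `1 = 1`. -/
inductive ZeroHeckeRel (m : CoxeterMatrix I) : FreeMonoid I → FreeMonoid I → Prop
  | idem (i : I) : ZeroHeckeRel m (FreeMonoid.of i * FreeMonoid.of i) (FreeMonoid.of i)
  | braid (i j : I) : ZeroHeckeRel m (altWord i j (m i j)) (altWord j i (m i j))

/-- The 0-Hecke monoid, given by its Coxeter presentation. -/
abbrev ZeroHeckeMonoid (m : CoxeterMatrix I) : Type _ := PresentedMonoid (ZeroHeckeRel m)

/-- The generator `π_i`. -/
def heckeGen (m : CoxeterMatrix I) (i : I) : ZeroHeckeMonoid m :=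
  PresentedMonoid.of (ZeroHeckeRel m) i

/-- The length of an element: the least length of a word in the generators representing it. -/
noncomputable def heckeLength (m : CoxeterMatrix I) (x : ZeroHeckeMonoid m) : ℕ :=
  sInf {n | ∃ w : FreeMonoid I, w.length = n ∧ PresentedMonoid.mk (ZeroHeckeRel m) w = x}

/-- The parabolic submonoid generated by `π_j`, `j ∈ J`. -/
def heckeParabolic (m : CoxeterMatrix I) (J : Set I) : Submonoid (ZeroHeckeMonoid m) :=
  Submonoid.closure (heckeGen m '' J)

/-- `x` is an element of maximal length in the parabolic submonoid of `J`. -/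
def IsLongestInParabolic (m : CoxeterMatrix I) (J : Set I) (x : ZeroHeckeMonoid m) : Prop :=
  x ∈ heckeParabolic m J ∧ ∀ y ∈ heckeParabolic m J, heckeLength m y ≤ heckeLength m x

/-- `π_J`, the longest element of the parabolic submonoid of `J`. It exists and is unique when
the Coxeter group is finite. -/
noncomputable def heckePi (m : CoxeterMatrix I) (J : Set I) : ZeroHeckeMonoid m :=
  Classical.epsilon (IsLongestInParabolic m J)

/-- `J` and `K` are incomparable, and `π_j`, `π_k` do not commute for all `j ∈ J ∖ K` and
`k ∈ K ∖ J`. -/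
def IsQuiverPair (m : CoxeterMatrix I) (J K : Set I) : Prop :=
  ¬ J ⊆ K ∧ ¬ K ⊆ J ∧
    ∀ j ∈ J \ K, ∀ k ∈ K \ J, ¬ Commute (heckeGen m j) (heckeGen m k)

end ZeroHecke

/-! Coxeter theory enters through a single fact: multiplying by a generator, on either side, fixes
an element of `ZeroHeckeMonoid m` or makes it strictly longer. It is read off from a surjection w ↦
π_w of W onto the monoid that preserves length. Matsumoto's theorem makes the map well defined; that
theorem rests on the exchange property and on the fact that s_i s_j has order exactly m(i,j), seen
in the geometric representation. Lengths do not drop because a word determines the set of products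
of its subwords, even modulo the 0-Hecke relations.

Hence the monoid is J-trivial, and the elements fixing x on the left form the parabolic submonoid of
J = `leftFixers x`, so lfix(x) = π_J; likewise rfix(x) = π_K. A factorization x = uv is then
non-trivial exactly when u and v lie outside the parabolic submonoids of J and K.

If x is a quiver element, cutting it at its first letter i outside J forces x = π_J π_i π_K. Were i
outside K, doubling π_i would give a non-trivial factorization; so x = π_J π_K. Commuting j ∈ J∖K
and k ∈ K∖J would give the non-trivial factorization (π_J π_k)(π_j π_K).

Conversely, a non-commuting pair j, k yields a homomorphism to the self-maps of {0, 1, 2} under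
which π_j lowers 2, π_k lowers 1 and all other generators act trivially. There π_J π_K sends 2 to 1,
whereas a product with a π_k to the left of a π_j sends 2 to 0. This determines the fixers of π_J
π_K and rules out non-trivial factorizations; the pair (J, K) is recovered from the fixers. -/

namespace CoxeterSystem

/-! ### The geometric representation and the order of s_i s_j -/

section GeometricRepresentation

variable {B : Type*} (M : CoxeterMatrix B)

/-- The coroot `2 B(α_i, ·)` of the geometric representation of a Coxeter group. -/
noncomputable def geomCoroot (i : B) : Module.Dual ℝ (B →₀ ℝ) :=
  Finsupp.linearCombination ℝ fun j => -2 * Real.cos (Real.pi / M i j)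

/-- The case m = ∞ is included: the entry `0` gives π/0 = 0, hence the pairing -2. -/
theorem geomCoroot_single (i j : B) :
    geomCoroot M i (Finsupp.single j 1) = -2 * Real.cos (Real.pi / M i j) := by
  simp [geomCoroot]

theorem geomCoroot_self (i : B) : geomCoroot M i (Finsupp.single i 1) = 2 := by
  simp [geomCoroot_single]

/-- This is the parameter at which the Chebyshev polynomials are evaluated in the formula for powers
of a product of two reflections. -/
theorem geomCoroot_mul_sub_two (i j : B) :
    geomCoroot M i (Finsupp.single j 1) * geomCoroot M j (Finsupp.single i 1) - 2 =
      2 * Real.cos (2 * (Real.pi / M i j)) := by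
  rw [geomCoroot_single, geomCoroot_single, M.symmetric j i, Real.cos_two_mul]
  ring

/-- The reflection by which a simple generator acts in the geometric representation. -/
noncomputable def geomReflection (i : B) : (B →₀ ℝ) ≃ₗ[ℝ] (B →₀ ℝ) :=
  Module.reflection (geomCoroot_self M i)

theorem sin_two_mul_pi_div_ne_zero {n : ℕ} (hn : 3 ≤ n) :
    Real.sin (2 * (Real.pi / n)) ≠ 0 := by
  have h3 : (3 : ℝ) ≤ n := by exact_mod_cast hn
  have hpi := Real.pi_pos
  refine (Real.sin_pos_of_pos_of_lt_pi (by positivity) ?_).ne'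
  rw [← mul_div_assoc, div_lt_iff₀ (by linarith)]
  nlinarith

theorem geomReflection_mul_pow (i j : B) :
    (geomReflection M i * geomReflection M j) ^ M i j = 1 := by
  have key : ∀ n : ℕ, M i j = n → (geomReflection M i * geomReflection M j) ^ n = 1 := by
    intro n hn
    obtain rfl | rfl | rfl | h3 : n = 0 ∨ n = 1 ∨ n = 2 ∨ 3 ≤ n := by omega
    · simp
    · obtain rfl : i = j := by
        by_contra h
        exact M.off_diagonal i j h hn
      rw [pow_one]
      ext1 z
      simp [geomReflection, Module.involutive_reflection _ _]
    -- The case m = 2 stands apart because sin(2π/2) = 0 cannot be cancelled below.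
    · have hij : geomCoroot M i (Finsupp.single j 1) = 0 := by
        simp [geomCoroot_single, hn]
      have hji : geomCoroot M j (Finsupp.single i 1) = 0 := by
        simp [geomCoroot_single, M.symmetric j i, hn]
      apply LinearEquiv.ext
      intro z
      simp only [pow_two, geomReflection, LinearEquiv.mul_apply, Module.reflection_apply, map_sub,
        map_smul, hij, hji, geomCoroot_self, LinearEquiv.coe_one, id]
      module
    · apply LinearEquiv.ext
      intro z
      have ht := geomCoroot_mul_sub_two M i j
      have hs := sin_two_mul_pi_div_ne_zero h3
      have hpi : (n : ℝ) * (Real.pi / n) = Real.pi := by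
        field_simp
      have hS := fun k : ℤ => Polynomial.Chebyshev.S_two_mul_real_cos (2 * (Real.pi / n)) k
      have hfor := Module.reflection_mul_reflection_pow_apply (geomCoroot_self M i)
        (geomCoroot_self M j) n z _ ht.symm
      rw [geomReflection, geomReflection, hfor, hn]
      -- The Chebyshev indices are halves of n rounded down, hence the split by parity.
      obtain ⟨k, rfl | rfl⟩ : ∃ k, n = 2 * k ∨ n = 2 * k + 1 := ⟨n / 2, by omega⟩
      · have h0 : Polynomial.eval (2 * Real.cos (2 * (Real.pi / ↑(2 * k))))
            (Polynomial.Chebyshev.S ℝ (k - 1)) = 0 := by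
          have := hS (k - 1)
          have e : (((k - 1 : ℤ) : ℝ) + 1) * (2 * (Real.pi / ↑(2 * k))) = Real.pi := by
            push_cast at hpi ⊢; linear_combination hpi
          rw [e, Real.sin_pi] at this
          exact (mul_eq_zero.1 this).resolve_right hs
        have e1 : (((2 * k : ℕ) : ℤ) - 2) / 2 = k - 1 := by omega
        have e2 : (((2 * k : ℕ) : ℤ) - 1) / 2 = k - 1 := by omega
        rw [e1, e2, h0]
        simp
      · have h0 : Polynomial.eval (2 * Real.cos (2 * (Real.pi / ↑(2 * k + 1))))
            (Polynomial.Chebyshev.S ℝ k) + Polynomial.eval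
              (2 * Real.cos (2 * (Real.pi / ↑(2 * k + 1))))
            (Polynomial.Chebyshev.S ℝ (k - 1)) = 0 := by
          have h1 := hS (k - 1)
          have h2 := hS k
          have e : (((k : ℤ) : ℝ) + 1) * (2 * (Real.pi / ↑(2 * k + 1))) =
              2 * Real.pi - (((k - 1 : ℤ) : ℝ) + 1) * (2 * (Real.pi / ↑(2 * k + 1))) := by
            push_cast at hpi ⊢; linear_combination 2 * hpi
          rw [e, Real.sin_two_pi_sub] at h2
          refine (mul_eq_zero.1 ?_).resolve_right hs
          rw [add_mul, h1, h2]; ring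
        have e1 : (((2 * k + 1 : ℕ) : ℤ) - 2) / 2 = k - 1 := by omega
        have e2 : (((2 * k + 1 : ℕ) : ℤ) - 1) / 2 = k := by omega
        have e3 : (((2 * k + 1 : ℕ) : ℤ) - 3) / 2 = k - 1 := by omega
        have e4 : ((2 * k + 1 : ℕ) : ℤ) / 2 = k := by omega
        rw [e1, e2, e3, e4, h0]
        simp
  exact key _ rfl

theorem dvd_of_geomReflection_mul_pow {i j : B} (hij : i ≠ j) {n : ℕ}
    (h : (geomReflection M i * geomReflection M j) ^ n = 1) : M i j ∣ n := by
  have key : ∀ p : ℕ, M i j = p → p ∣ n := by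
    intro p hp
    have hp1 : p ≠ 1 := hp ▸ M.off_diagonal i j hij
    by_cases hp2 : p = 2
    · subst hp2
      have h1 : ¬ Odd n := by
        rintro ⟨k, rfl⟩
        have h2 := geomReflection_mul_pow M i j
        rw [hp] at h2
        rw [pow_succ, pow_mul, h2, one_pow, one_mul] at h
        have hji : geomCoroot M j (Finsupp.single i 1) = 0 := by
          simp [geomCoroot_single, M.symmetric j i, hp]
        have h3 := DFunLike.congr_fun h (Finsupp.single i 1)
        simp only [geomReflection, LinearEquiv.mul_apply, Module.reflection_apply, hji, zero_smul,
          sub_zero, geomCoroot_self, LinearEquiv.coe_one, id] at h3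
        have h4 := DFunLike.congr_fun h3 i
        norm_num at h4
      exact (Nat.not_odd_iff_even.1 h1).two_dvd
    · have hx := Module.reflection_mul_reflection_pow_apply_self (geomCoroot_self M i)
        (geomCoroot_self M j) n _ (geomCoroot_mul_sub_two M i j).symm
      change ((geomReflection M i * geomReflection M j) ^ n) _ = _ at hx
      have hg : geomCoroot M j (Finsupp.single i 1) = -2 * Real.cos (Real.pi / p) := by
        rw [geomCoroot_single, M.symmetric j i, hp]
      rw [h, hp, hg] at hx
      simp only [LinearEquiv.coe_one, id] at hx
      have hi := DFunLike.congr_fun hx i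
      have hj := DFunLike.congr_fun hx j
      simp [hij, hij.symm] at hi hj
      obtain rfl | h3 : p = 0 ∨ 3 ≤ p := by omega
      -- For m = ∞ the argument is 2 and the coefficient of α_j is a multiple of S_{n-1}(2) = n.
      · simp [Polynomial.Chebyshev.S_eval_two] at hj
        simp [hj]
      · have hs := sin_two_mul_pi_div_ne_zero h3
        have hc : Real.cos (Real.pi / p) ≠ 0 := by
          intro h0
          apply hs
          rw [Real.sin_two_mul, h0, mul_zero]
        replace hj := hj.resolve_right (by simpa using hc)
        -- With θ = 2π/p the two coordinates say sin(nθ) = 0 and sin((n+1)θ) = sin θ, so cos(nθ) =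
        -- 1.
        have hS := Polynomial.Chebyshev.S_two_mul_real_cos (2 * (Real.pi / p)) n
        rw [hj, add_zero] at hi
        have hS' := Polynomial.Chebyshev.S_two_mul_real_cos (2 * (Real.pi / p)) (n - 1)
        rw [hj, zero_mul] at hS'
        rw [← hi, one_mul] at hS
        push_cast at hS hS'
        rw [sub_add_cancel] at hS'
        rw [add_mul, one_mul, Real.sin_add, ← hS', zero_mul, zero_add] at hS
        have hcos : Real.cos (n * (2 * (Real.pi / p))) = 1 :=
          mul_right_cancel₀ hs (by rw [← hS, one_mul])
        obtain ⟨k, hk⟩ := (Real.cos_eq_one_iff _).1 hcos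
        have hp0 : (p : ℝ) ≠ 0 := by positivity
        have : (n : ℝ) = p * k := by
          have hpi := Real.pi_ne_zero
          field_simp at hk
          linarith
        have : (n : ℤ) = p * k := by exact_mod_cast this
        exact Int.natCast_dvd_natCast.1 ⟨k, this⟩
  exact key _ rfl

variable {M} {W : Type*} [Group W] (cs : CoxeterSystem M W)

theorem orderOf_simple_mul_simple (i j : B) : orderOf (cs.simple i * cs.simple j) = M i j := by
  apply Nat.dvd_antisymm
  · exact orderOf_dvd_of_pow_eq_one (cs.simple_mul_simple_pow i j)
  · by_cases hij : i = j
    · subst hij; simp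
    · apply dvd_of_geomReflection_mul_pow M hij
      have hlift : M.IsLiftable (geomReflection M) := geomReflection_mul_pow M
      have := congrArg (cs.lift ⟨_, hlift⟩) (pow_orderOf_eq_one (cs.simple i * cs.simple j))
      rwa [map_pow, map_mul, map_one, lift_apply_simple, lift_apply_simple] at this

end GeometricRepresentation

end CoxeterSystem

namespace CoxeterSystem

/-! ### Parity of inversions and the exchange property -/

section Exchange

open Classical in
/-- The generators of the action of `W` on `W × ZMod 2` that conjugates the first coordinate and
counts in the second one how often a reflection is inverted. -/
noncomputable def inversionParityGen {B W : Type*} {M : CoxeterMatrix B} [Group W]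
    (cs : CoxeterSystem M W) (i : B) : Function.End (W × ZMod 2) :=
  fun p => (cs.simple i * p.1 * cs.simple i, p.2 + if p.1 = cs.simple i then 1 else 0)

variable {B W : Type*} {M : CoxeterMatrix B} [Group W] (cs : CoxeterSystem M W)

theorem simple_mul_simple_mul_simple_pow (i j : B) (n : ℕ) :
    cs.simple j * (cs.simple i * cs.simple j) ^ n =
      ((cs.simple i * cs.simple j) ^ n)⁻¹ * cs.simple j := by
  have h : SemiconjBy (cs.simple j) (cs.simple i * cs.simple j) (cs.simple i * cs.simple j)⁻¹ := by
    simp [SemiconjBy, mul_assoc]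
  rw [← inv_pow]
  exact h.pow_right n

open Classical in
theorem inversionParityGen_mul_pow_apply (i j : B) (n : ℕ) (t : W) (ε : ZMod 2) :
    ((cs.inversionParityGen i * cs.inversionParityGen j) ^ n : Function.End (W × ZMod 2)) (t, ε) =
      ((cs.simple i * cs.simple j) ^ n * t * ((cs.simple i * cs.simple j) ^ n)⁻¹,
        ε + ∑ l ∈ Finset.range (2 * n),
          if t = ((cs.simple i * cs.simple j) ^ l)⁻¹ * cs.simple j then 1 else 0) := by
  induction n with
  | zero => simp; rfl
  | succ n ih =>
    rw [pow_succ']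
    change cs.inversionParityGen i (cs.inversionParityGen j (((cs.inversionParityGen i *
      cs.inversionParityGen j) ^ n : Function.End (W × ZMod 2)) (t, ε))) = _
    rw [ih]
    have hc := cs.simple_mul_simple_mul_simple_pow i j
    have hcj : (cs.simple i * cs.simple j)⁻¹ * cs.simple j =
        cs.simple j * cs.simple i * cs.simple j := by simp
    set c := cs.simple i * cs.simple j with hcdef
    have h1 : c ^ n * t * (c ^ n)⁻¹ = cs.simple j ↔ t = (c ^ (2 * n))⁻¹ * cs.simple j := by
      rw [mul_inv_eq_iff_eq_mul, hc, two_mul, pow_add, ← eq_inv_mul_iff_mul_eq, mul_inv_rev,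
        mul_assoc]
    have h2 : cs.simple j * (c ^ n * t * (c ^ n)⁻¹) * cs.simple j = cs.simple i ↔
        t = (c ^ (2 * n + 1))⁻¹ * cs.simple j := by
      have e : cs.simple j * (c ^ n * t * (c ^ n)⁻¹) * cs.simple j = cs.simple i ↔
          c ^ n * t * (c ^ n)⁻¹ = c⁻¹ * cs.simple j := by
        constructor
        · intro h
          rw [hcj, ← h]
          simp [mul_assoc]
        · intro h
          rw [h, hcj]
          simp [mul_assoc]
      rw [e, mul_inv_eq_iff_eq_mul, mul_assoc, hc, two_mul, pow_succ', pow_add,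
        ← eq_inv_mul_iff_mul_eq]
      simp only [mul_inv_rev, mul_assoc]
      rw [show c⁻¹ * ((c ^ n)⁻¹ * cs.simple j) = (c ^ n)⁻¹ * (c⁻¹ * cs.simple j) by
        rw [← mul_assoc, ← mul_assoc, ((Commute.refl c).pow_right n).inv_inv.eq]]
    simp only [inversionParityGen, h1, h2]
    rw [show 2 * (n + 1) = 2 * n + 1 + 1 by ring, Finset.sum_range_succ, Finset.sum_range_succ]
    refine Prod.ext ?_ ?_
    · simp only [pow_succ', mul_inv_rev, mul_assoc, hcdef, inv_simple]
    · simp only [add_assoc]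

/-- At n = m(i,j) the 2n reflections in the sum run twice through one list, so the count vanishes
modulo 2. -/
theorem isLiftable_inversionParityGen : M.IsLiftable cs.inversionParityGen := by
  classical
  intro i j
  funext ⟨t, ε⟩
  rw [inversionParityGen_mul_pow_apply, simple_mul_simple_pow]
  change _ = (t, ε)
  refine Prod.ext (by simp) ?_
  have h : ∀ l, (cs.simple i * cs.simple j) ^ (M i j + l) = (cs.simple i * cs.simple j) ^ l := by
    intro l
    rw [pow_add, simple_mul_simple_pow, one_mul]
  simp only [two_mul, Finset.sum_range_add, h, CharTwo.add_self_eq_zero, add_zero]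

open Classical in
theorem lift_inversionParityGen_apply (ω : List B) (t : W) (ε : ZMod 2) :
    cs.lift ⟨_, cs.isLiftable_inversionParityGen⟩ (cs.wordProd ω) (t, ε) =
      (cs.wordProd ω * t * (cs.wordProd ω)⁻¹, ε + (cs.rightInvSeq ω).count t) := by
  induction ω with
  | nil => simp; rfl
  | cons i ω ih =>
    rw [wordProd_cons, map_mul, lift_apply_simple]
    change cs.inversionParityGen i
      ((cs.lift ⟨_, cs.isLiftable_inversionParityGen⟩ (cs.wordProd ω)) (t, ε)) = _
    rw [ih, inversionParityGen, rightInvSeq, List.count_cons]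
    have h : cs.wordProd ω * t * (cs.wordProd ω)⁻¹ = cs.simple i ↔
        (cs.wordProd ω)⁻¹ * cs.simple i * cs.wordProd ω = t := by
      rw [mul_inv_eq_iff_eq_mul, ← eq_inv_mul_iff_mul_eq, mul_assoc, eq_comm]
    simp only [h, beq_iff_eq]
    refine Prod.ext (by simp [mul_assoc]) ?_
    push_cast
    simp only [add_assoc]

open Classical in
/-- The parity of the number of occurrences of `t` among the inversions of a word depends only on
the group element. -/
theorem count_leftInvSeq_eq_of_wordProd_eq {ω ω' : List B} (h : cs.wordProd ω = cs.wordProd ω')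
    (t : W) : ((cs.leftInvSeq ω).count t : ZMod 2) = (cs.leftInvSeq ω').count t := by
  have h1 := cs.lift_inversionParityGen_apply ω.reverse t 0
  have h2 := cs.lift_inversionParityGen_apply ω'.reverse t 0
  rw [wordProd_reverse, h, ← wordProd_reverse, h2] at h1
  simpa [rightInvSeq_reverse] using (congrArg Prod.snd h1).symm

/-- The exchange property: a left descent of `w` is an inversion of every word for `w`. -/
theorem simple_mem_leftInvSeq_of_isLeftDescent {ω : List B} {i : B}
    (h : cs.IsLeftDescent (cs.wordProd ω) i) : cs.simple i ∈ cs.leftInvSeq ω := by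
  classical
  -- In the word i followed by a reduced word of s_i w, the reflection s_i is inverted exactly once;
  -- its count in ω is therefore odd.
  obtain ⟨ω', hω', hprod⟩ := cs.exists_isReduced (cs.simple i * cs.wordProd ω)
  have hprod' : cs.wordProd ω = cs.wordProd (i :: ω') := by
    rw [wordProd_cons, ← hprod, simple_mul_simple_cancel_left]
  have hnot : cs.simple i ∉ cs.leftInvSeq ω' := by
    intro hmem
    have := (cs.isLeftInversion_of_mem_leftInvSeq hω' hmem).2
    rw [← hprod, simple_mul_simple_cancel_left] at this
    exact absurd h (not_lt.2 this.le)
  by_contra hcon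
  have hc := cs.count_leftInvSeq_eq_of_wordProd_eq hprod' (cs.simple i)
  have hnot' : cs.simple i ∉ (cs.leftInvSeq ω').map (MulAut.conj (cs.simple i)) := by
    intro hm
    obtain ⟨y, hy, he⟩ := List.mem_map.1 hm
    apply hnot
    rwa [← show y = cs.simple i by
      rw [MulAut.conj_apply, mul_inv_eq_iff_eq_mul] at he
      exact mul_left_cancel he]
  rw [List.count_eq_zero_of_not_mem hcon, leftInvSeq, List.count_cons_self,
    List.count_eq_zero_of_not_mem hnot'] at hc
  simp at hc

end Exchange

/-! ### Matsumoto's theorem -/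

section Matsumoto

variable {B W : Type*} {M : CoxeterMatrix B} [Group W] (cs : CoxeterSystem M W)

/-- The alternating word `i, j, i, …` with `n` letters. -/
def altList {B : Type*} : B → B → ℕ → List B
  | _, _, 0 => []
  | i, j, n + 1 => i :: altList j i n

@[simp]
theorem length_altList {B : Type*} (i j : B) (n : ℕ) : (altList i j n).length = n := by
  induction n generalizing i j with
  | zero => rfl
  | succ n ih => simp [altList, ih]

theorem altList_eq_ite_alternatingWord {B : Type*} (i j : B) (n : ℕ) :
    altList i j n = if Even n then alternatingWord i j n else alternatingWord j i n := by
  induction n generalizing i j with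
  | zero => simp [altList, alternatingWord]
  | succ n ih =>
    rw [altList, ih]
    by_cases h : Even n
    · simp [h, alternatingWord_succ', Nat.even_add_one]
    · simp [h, alternatingWord_succ', Nat.even_add_one]

theorem wordProd_altList_comm (i j : B) :
    cs.wordProd (altList i j (M i j)) = cs.wordProd (altList j i (M i j)) := by
  have h := cs.wordProd_braidWord_eq i j
  rw [braidWord, braidWord, show M j i = M i j from M.symmetric j i] at h
  rw [altList_eq_ite_alternatingWord, altList_eq_ite_alternatingWord]
  split_ifs
  · exact h
  · exact h.symm

theorem exists_pow_of_mem_leftInvSeq_altList {i j : B} {n : ℕ} {t : W}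
    (h : t ∈ cs.leftInvSeq (altList i j n)) :
    ∃ p < n, t = (cs.simple i * cs.simple j) ^ p * cs.simple i := by
  induction n generalizing i j t with
  | zero => simp [altList] at h
  | succ n ih =>
    rw [altList, leftInvSeq, List.mem_cons, List.mem_map] at h
    obtain rfl | ⟨y, hy, rfl⟩ := h
    · exact ⟨0, by omega, by simp⟩
    · obtain ⟨p, hp, rfl⟩ := ih hy
      refine ⟨p + 1, by omega, ?_⟩
      rw [MulAut.conj_apply, inv_simple, pow_succ']
      have : SemiconjBy (cs.simple j) (cs.simple i * cs.simple j) (cs.simple j * cs.simple i) := by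
        simp [SemiconjBy, mul_assoc]
      rw [← (this.pow_right p).eq]
      simp only [mul_assoc]

/-- An element with left descents `i` and `j` has reduced words that start with the alternating
words in `i` and `j` with up to `M i j` letters. -/
theorem exists_altList_append {w : W} {i j : B} (hi : cs.IsLeftDescent w i)
    (hj : cs.IsLeftDescent w j) {k : ℕ} (hk : M i j = 0 ∨ k ≤ M i j) :
    ∃ u : List B, w = cs.wordProd (altList i j k ++ u) ∧ cs.length w = k + u.length := by
  induction k generalizing i j with
  | zero =>
    obtain ⟨u, hu, rfl⟩ := cs.exists_isReduced w
    exact ⟨u, by simp [altList], by simpa using hu.eq⟩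
  | succ k ih =>
    have hsymm : M j i = M i j := M.symmetric j i
    obtain ⟨u, hu, hlen⟩ := ih hj hi (by omega)
    have hmem := hi
    rw [hu] at hmem
    obtain ⟨n, hn, hget⟩ := List.mem_iff_getElem.1 (cs.simple_mem_leftInvSeq_of_isLeftDescent hmem)
    have herase := cs.getD_leftInvSeq_mul_wordProd (altList j i k ++ u) n
    rw [List.getD_eq_getElem _ _ hn, hget] at herase
    obtain hnk | hnk := lt_or_ge n k
    -- A deletion inside the alternating prefix would give (s_j s_i)^(p+1) = 1 with p + 1 ≤ k <
    -- m(i,j), against the order of s_j s_i.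
    · exfalso
      have : cs.simple i ∈ cs.leftInvSeq (altList j i k) := by
        have h1 : cs.leftInvSeq (altList j i k) =
            (cs.leftInvSeq (altList j i k ++ u)).take k := by
          rw [← leftInvSeq_take, List.take_left' (length_altList j i k)]
        rw [h1, ← hget]
        exact List.mem_iff_getElem.2 ⟨n, by simp; omega, by simp⟩
      obtain ⟨p, hp, he⟩ := cs.exists_pow_of_mem_leftInvSeq_altList this
      have h1 : (cs.simple j * cs.simple i) ^ (p + 1) = 1 := by
        rw [pow_succ, ← mul_assoc]
        have := cs.simple_mul_simple_mul_simple_pow j i p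
        have h2 : (cs.simple j * cs.simple i) ^ p * cs.simple j * cs.simple i = 1 := by
          rw [← he, simple_mul_simple_self]
        exact h2
      have h2 := orderOf_dvd_of_pow_eq_one h1
      rw [orderOf_simple_mul_simple, hsymm] at h2
      rcases hk with h0 | hk
      · rw [h0] at h2; simp at h2
      · have := Nat.le_of_dvd (by omega) h2
        omega
    · rw [List.eraseIdx_append_of_length_le (by simpa using hnk), length_altList] at herase
      have hn' : n - k < u.length := by simp at hn; omega
      refine ⟨u.eraseIdx (n - k), ?_, ?_⟩
      · rw [altList, List.cons_append, wordProd_cons, ← herase, ← hu,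
          simple_mul_simple_cancel_left]
      · have := List.length_eraseIdx_add_one hn'
        omega

theorem isLeftDescent_of_isReduced_cons {ω : List B} {i : B} (h : cs.IsReduced (i :: ω)) :
    cs.IsLeftDescent (cs.wordProd (i :: ω)) i := by
  rw [IsLeftDescent, h.eq, wordProd_cons, simple_mul_simple_cancel_left, List.length_cons]
  exact Nat.lt_succ_of_le (cs.length_wordProd_le ω)

/-- **Matsumoto's theorem**: in a monoid in which the images of the generators satisfy the braid
relations, all reduced words of an element have the same product. -/
theorem prod_map_eq_of_isReduced {N : Type*} [Monoid N] {f : B → N}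
    (hf : ∀ i j, ((altList i j (M i j)).map f).prod = ((altList j i (M i j)).map f).prod)
    {ω ω' : List B} (hω : cs.IsReduced ω) (hω' : cs.IsReduced ω')
    (h : cs.wordProd ω = cs.wordProd ω') : (ω.map f).prod = (ω'.map f).prod := by
  have hlen : ω'.length = ω.length := by rw [← hω.eq, ← hω'.eq, h]
  obtain ⟨n, hn⟩ : ∃ n, n = ω.length := ⟨_, rfl⟩
  induction n generalizing ω ω' with
  | zero =>
    rw [List.length_eq_zero_iff.1 hn.symm, List.length_eq_zero_iff.1 (hlen.trans hn.symm)]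
  | succ n ih =>
    have tail : ∀ {a : B} {v v' : List B}, cs.IsReduced (a :: v) → cs.IsReduced (a :: v') →
        cs.wordProd (a :: v) = cs.wordProd (a :: v') → n = v.length →
        (v.map f).prod = (v'.map f).prod := by
      intro a v v' hv hv' he hl
      have hl' : v'.length = v.length := by
        have := hv.eq
        rw [he, hv'.eq] at this
        simpa using this
      refine ih (hv.drop 1) (hv'.drop 1) ?_ hl' hl
      rw [wordProd_cons, wordProd_cons] at he
      exact mul_left_cancel he
    obtain ⟨i, u, rfl⟩ := List.exists_cons_of_length_eq_add_one hn.symm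
    obtain ⟨j, v, rfl⟩ := List.exists_cons_of_length_eq_add_one (hlen.trans hn.symm)
    have hi := cs.isLeftDescent_of_isReduced_cons hω
    have hj := cs.isLeftDescent_of_isReduced_cons hω'
    rw [← h] at hj
    have hu : n = u.length := by simpa using hn
    have hv : n = v.length := by simpa [hu] using hlen.symm
    have hM : M i j ≠ 0 := by
      intro h0
      -- An infinite m(i,j) would allow an alternating prefix one letter longer than w, whose length
      -- is n + 1.
      obtain ⟨z, -, hz⟩ := cs.exists_altList_append hi hj (k := n + 2) (Or.inl h0)
      rw [hω.eq, List.length_cons] at hz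
      omega
    obtain ⟨k, hk⟩ := Nat.exists_eq_succ_of_ne_zero hM
    obtain ⟨z, hz, hzl⟩ := cs.exists_altList_append hi hj (k := M i j) (Or.inr le_rfl)
    have hz' : cs.wordProd (altList j i (M i j) ++ z) = cs.wordProd (i :: u) := by
      have hb := cs.wordProd_altList_comm i j
      rw [hz, wordProd_append, wordProd_append, hb]
    have hr : ∀ a b, cs.wordProd (altList a b (M i j) ++ z) = cs.wordProd (i :: u) →
        cs.IsReduced (altList a b (M i j) ++ z) := by
      intro a b hab
      rw [IsReduced, hab, hzl, List.length_append, length_altList]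
    have hr1 := hr i j hz.symm
    have hr2 := hr j i hz'
    have e1 : ((i :: u).map f).prod = ((altList i j (M i j) ++ z).map f).prod := by
      -- Both words now start with i, so the induction hypothesis applies to the tails; `hf` will
      -- link the two alternating prefixes.
      rw [hk, altList, List.cons_append] at hr1 hz ⊢
      rw [List.map_cons, List.map_cons, List.prod_cons, List.prod_cons, tail hω hr1 hz hu]
    have e2 : ((j :: v).map f).prod = ((altList j i (M i j) ++ z).map f).prod := by
      rw [h] at hz'
      rw [hk, altList, List.cons_append] at hr2 hz' ⊢
      rw [List.map_cons, List.map_cons, List.prod_cons, List.prod_cons, tail hω' hr2 hz'.symm hv]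
    rw [e1, e2, List.map_append, List.map_append, List.prod_append, List.prod_append, hf]

end Matsumoto

end CoxeterSystem

/-! ### Words and the universal property of the 0-Hecke monoid -/

section HeckeElements

variable {I : Type*} {m : CoxeterMatrix I}

theorem freeMonoid_lift_altWord {N : Type*} [Monoid N] (f : I → N) (i j : I) (n : ℕ) :
    FreeMonoid.lift f (altWord i j n) = ((CoxeterSystem.altList i j n).map f).prod := by
  induction n generalizing i j with
  | zero => simp [altWord, CoxeterSystem.altList]
  | succ n ih => simp [altWord, CoxeterSystem.altList, ih]

/-- A map to a monoid whose values satisfy the 0-Hecke relations extends to the 0-Hecke monoid. -/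
noncomputable def heckeLift {N : Type*} [Monoid N] (f : I → N) (hidem : ∀ i, f i * f i = f i)
    (hbraid : ∀ i j, ((CoxeterSystem.altList i j (m i j)).map f).prod =
      ((CoxeterSystem.altList j i (m i j)).map f).prod) : ZeroHeckeMonoid m →* N :=
  PresentedMonoid.lift f (by
    rintro _ _ (⟨i⟩ | ⟨i, j⟩)
    · simpa using hidem i
    · rw [freeMonoid_lift_altWord, freeMonoid_lift_altWord, hbraid])

@[simp]
theorem heckeLift_heckeGen {N : Type*} [Monoid N] (f : I → N) (hidem : ∀ i, f i * f i = f i)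
    (hbraid : ∀ i j, ((CoxeterSystem.altList i j (m i j)).map f).prod =
      ((CoxeterSystem.altList j i (m i j)).map f).prod) (i : I) :
    heckeLift f hidem hbraid (heckeGen m i) = f i :=
  PresentedMonoid.lift_of ..

theorem mk_eq_prod_map_heckeGen (w : FreeMonoid I) :
    PresentedMonoid.mk (ZeroHeckeRel m) w = (w.toList.map (heckeGen m)).prod := by
  have h : PresentedMonoid.mk (ZeroHeckeRel m) = FreeMonoid.lift (heckeGen m) :=
    FreeMonoid.hom_eq fun i => by simp [heckeGen, PresentedMonoid.of]
  rw [h, FreeMonoid.lift_apply]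

theorem heckeGen_mul_self (i : I) : heckeGen m i * heckeGen m i = heckeGen m i := by
  have := PresentedMonoid.mk_eq_mk_of_rel (ZeroHeckeRel.idem (m := m) i)
  rwa [map_mul] at this

theorem heckeGen_braid (i j : I) :
    ((CoxeterSystem.altList i j (m i j)).map (heckeGen m)).prod =
      ((CoxeterSystem.altList j i (m i j)).map (heckeGen m)).prod := by
  have := PresentedMonoid.mk_eq_mk_of_rel (ZeroHeckeRel.braid (m := m) i j)
  rwa [mk_eq_prod_map_heckeGen, mk_eq_prod_map_heckeGen, ← FreeMonoid.lift_apply,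
    ← FreeMonoid.lift_apply, freeMonoid_lift_altWord, freeMonoid_lift_altWord] at this

theorem exists_prod_map_heckeGen_eq (x : ZeroHeckeMonoid m) :
    ∃ ω : List I, (ω.map (heckeGen m)).prod = x := by
  obtain ⟨w, rfl⟩ := PresentedMonoid.surjective_mk x
  exact ⟨w.toList, (mk_eq_prod_map_heckeGen w).symm⟩

theorem heckeLength_prod_le (ω : List I) :
    heckeLength m (ω.map (heckeGen m)).prod ≤ ω.length :=
  Nat.sInf_le ⟨FreeMonoid.ofList ω, rfl, mk_eq_prod_map_heckeGen _⟩

theorem exists_word_heckeLength (x : ZeroHeckeMonoid m) :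
    ∃ ω : List I, ω.length = heckeLength m x ∧ (ω.map (heckeGen m)).prod = x := by
  have hne : {n | ∃ w : FreeMonoid I, w.length = n ∧
      PresentedMonoid.mk (ZeroHeckeRel m) w = x}.Nonempty := by
    obtain ⟨w, rfl⟩ := PresentedMonoid.surjective_mk x
    exact ⟨_, w, rfl, rfl⟩
  obtain ⟨w, hw, hx⟩ := Nat.sInf_mem hne
  exact ⟨w.toList, hw, by rw [← hx, mk_eq_prod_map_heckeGen]⟩

end HeckeElements

/-! ### The length-preserving surjection from W -/

section CoxeterToHecke

variable {I W : Type*} [Group W] {m : CoxeterMatrix I} (cs : CoxeterSystem m W)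

namespace CoxeterSystem

open scoped Pointwise

/-- The bounds k ≤ n and k < n make the set symmetric in i and j except for the longest word; at n =
m(i,j) its two versions agree in W, which is the braid relation for `subwordSet`. -/
theorem prod_map_pair_altList (i j : I) (n : ℕ) :
    ((altList i j n).map fun a => ({1, cs.simple a} : Set W)).prod =
      {x | (∃ k ≤ n, x = cs.wordProd (altList i j k)) ∨
        ∃ k < n, x = cs.wordProd (altList j i k)} := by
  induction n generalizing i j with
  | zero =>
    ext x
    simp [altList]
  | succ n ih =>
    rw [altList, List.map_cons, List.prod_cons, ih]
    ext x
    simp only [Set.mem_mul, Set.mem_insert_iff, Set.mem_singleton_iff, Set.mem_ofPred_eq]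
    constructor
    · rintro ⟨a, rfl | rfl, y, ⟨k, hk, rfl⟩ | ⟨k, hk, rfl⟩, rfl⟩
      · exact Or.inr ⟨k, by omega, one_mul _⟩
      · exact Or.inl ⟨k, by omega, one_mul _⟩
      · exact Or.inl ⟨k + 1, by omega, by rw [altList, wordProd_cons]⟩
      · cases k with
        | zero => exact Or.inl ⟨1, by omega, by simp [altList]⟩
        | succ k =>
          exact Or.inr ⟨k, by omega, by
            rw [altList, wordProd_cons, simple_mul_simple_cancel_left]⟩
    · rintro (⟨k, hk, rfl⟩ | ⟨k, hk, rfl⟩)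
      · cases k with
        | zero => exact ⟨1, Or.inl rfl, 1, Or.inl ⟨0, by omega, by simp [altList]⟩, by
            simp [altList]⟩
        | succ k => exact ⟨_, Or.inr rfl, _, Or.inl ⟨k, by omega, rfl⟩, by
            rw [altList, wordProd_cons]⟩
      · exact ⟨1, Or.inl rfl, _, Or.inl ⟨k, by omega, rfl⟩, one_mul _⟩

/-- The homomorphism from the 0-Hecke monoid to the sets of group elements that sends the class of
a word to the set of the products of its subwords. -/
noncomputable def subwordSet : ZeroHeckeMonoid m →* Set W :=
  heckeLift (fun i => ({1, cs.simple i} : Set W))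
    (fun i => by
      ext x
      simp only [Set.mem_mul, Set.mem_insert_iff, Set.mem_singleton_iff]
      constructor
      · rintro ⟨a, rfl | rfl, b, rfl | rfl, rfl⟩ <;> simp
      · rintro (rfl | rfl)
        · exact ⟨1, Or.inl rfl, 1, Or.inl rfl, one_mul 1⟩
        · exact ⟨1, Or.inl rfl, _, Or.inr rfl, one_mul _⟩)
    (fun i j => by
      have h := cs.wordProd_altList_comm i j
      rw [prod_map_pair_altList, prod_map_pair_altList]
      ext x
      constructor <;>
      · rintro (⟨k, hk, rfl⟩ | ⟨k, hk, rfl⟩)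
        · obtain rfl | hk := hk.eq_or_lt
          · first
            | exact Or.inl ⟨_, le_rfl, h⟩
            | exact Or.inl ⟨_, le_rfl, h.symm⟩
          · exact Or.inr ⟨k, hk, rfl⟩
        · exact Or.inl ⟨k, hk.le, rfl⟩)

theorem wordProd_mem_subwordSet (ω : List I) :
    cs.wordProd ω ∈ cs.subwordSet (ω.map (heckeGen m)).prod := by
  induction ω with
  | nil => simp
  | cons i ω ih =>
    rw [List.map_cons, List.prod_cons, map_mul, subwordSet, heckeLift_heckeGen, wordProd_cons]
    exact Set.mul_mem_mul (Or.inr rfl) ih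

theorem length_le_of_mem_subwordSet {ω : List I} {x : W}
    (hx : x ∈ cs.subwordSet (ω.map (heckeGen m)).prod) : cs.length x ≤ ω.length := by
  induction ω generalizing x with
  | nil => simp at hx; simp [hx]
  | cons i ω ih =>
    rw [List.map_cons, List.prod_cons, map_mul, subwordSet, heckeLift_heckeGen] at hx
    obtain ⟨a, rfl | rfl, y, hy, rfl⟩ := hx
    · simpa using (ih hy).trans (Nat.le_succ _)
    · have h1 := cs.length_mul_le (cs.simple i) y
      have h2 := ih hy
      rw [length_simple] at h1
      simp only [List.length_cons]
      omega

/-- The element `π_w` of the 0-Hecke monoid. -/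
noncomputable def toHecke (w : W) : ZeroHeckeMonoid m :=
  ((cs.exists_isReduced w).choose.map (heckeGen m)).prod

theorem toHecke_wordProd {ω : List I} (hω : cs.IsReduced ω) :
    cs.toHecke (cs.wordProd ω) = (ω.map (heckeGen m)).prod :=
  have h := (cs.exists_isReduced (cs.wordProd ω)).choose_spec
  cs.prod_map_eq_of_isReduced heckeGen_braid h.1 hω h.2.symm

/-- The subword set of π_w contains w, while a word with n letters has only subword products of
length at most n. So no word for π_w is shorter than w. -/
theorem heckeLength_toHecke (w : W) : heckeLength m (cs.toHecke w) = cs.length w := by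
  obtain ⟨ω, hω, rfl⟩ := cs.exists_isReduced w
  rw [cs.toHecke_wordProd hω]
  apply le_antisymm
  · exact (heckeLength_prod_le ω).trans hω.eq.ge
  · obtain ⟨ω', hlen, hprod⟩ := exists_word_heckeLength (ω.map (heckeGen m)).prod
    rw [← hlen]
    apply cs.length_le_of_mem_subwordSet
    rw [hprod]
    exact cs.wordProd_mem_subwordSet ω

theorem heckeGen_mul_toHecke_of_not_isLeftDescent {w : W} {i : I} (h : ¬ cs.IsLeftDescent w i) :
    heckeGen m i * cs.toHecke w = cs.toHecke (cs.simple i * w) := by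
  obtain ⟨ω, hω, rfl⟩ := cs.exists_isReduced w
  have hr : cs.IsReduced (i :: ω) := by
    rw [IsReduced, wordProd_cons, cs.not_isLeftDescent_iff.1 h, hω.eq, List.length_cons]
  rw [← wordProd_cons, cs.toHecke_wordProd hr, cs.toHecke_wordProd hω, List.map_cons,
    List.prod_cons]

theorem heckeGen_mul_toHecke_of_isLeftDescent {w : W} {i : I} (h : cs.IsLeftDescent w i) :
    heckeGen m i * cs.toHecke w = cs.toHecke w := by
  have h1 := cs.heckeGen_mul_toHecke_of_not_isLeftDescent
    (cs.isLeftDescent_iff_not_isLeftDescent_mul.1 h)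
  rw [simple_mul_simple_cancel_left] at h1
  rw [← h1, ← mul_assoc, heckeGen_mul_self]

theorem toHecke_mul_heckeGen_of_not_isRightDescent {w : W} {i : I}
    (h : ¬ cs.IsRightDescent w i) :
    cs.toHecke w * heckeGen m i = cs.toHecke (w * cs.simple i) := by
  obtain ⟨ω, hω, rfl⟩ := cs.exists_isReduced w
  have hp : cs.wordProd (ω ++ [i]) = cs.wordProd ω * cs.simple i := by simp [wordProd_append]
  have hr : cs.IsReduced (ω ++ [i]) := by
    rw [IsReduced, hp, cs.not_isRightDescent_iff.1 h, hω.eq]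
    simp
  rw [← hp, cs.toHecke_wordProd hr, cs.toHecke_wordProd hω]
  simp

theorem toHecke_mul_heckeGen_of_isRightDescent {w : W} {i : I} (h : cs.IsRightDescent w i) :
    cs.toHecke w * heckeGen m i = cs.toHecke w := by
  have h1 := cs.toHecke_mul_heckeGen_of_not_isRightDescent
    (cs.isRightDescent_iff_not_isRightDescent_mul.1 h)
  rw [simple_mul_simple_cancel_right] at h1
  rw [← h1, mul_assoc, heckeGen_mul_self]

theorem toHecke_surjective : Function.Surjective cs.toHecke := by
  intro x
  obtain ⟨ω, rfl⟩ := exists_prod_map_heckeGen_eq x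
  induction ω with
  | nil => exact ⟨cs.wordProd [], cs.toHecke_wordProd (by simp [IsReduced])⟩
  | cons i ω ih =>
    obtain ⟨w, hw⟩ := ih
    rw [List.map_cons, List.prod_cons, ← hw]
    by_cases h : cs.IsLeftDescent w i
    · exact ⟨w, (cs.heckeGen_mul_toHecke_of_isLeftDescent h).symm⟩
    · exact ⟨_, (cs.heckeGen_mul_toHecke_of_not_isLeftDescent h).symm⟩

theorem finite_zeroHeckeMonoid (cs : CoxeterSystem m W) [Finite W] : Finite (ZeroHeckeMonoid m) :=
  Finite.of_surjective _ cs.toHecke_surjective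

/-- With its mirror image and finiteness, this is all that the rest needs from the Coxeter group. -/
theorem heckeGen_mul_eq_or_length_lt (cs : CoxeterSystem m W) (i : I) (x : ZeroHeckeMonoid m) :
    heckeGen m i * x = x ∨ heckeLength m x < heckeLength m (heckeGen m i * x) := by
  obtain ⟨w, rfl⟩ := cs.toHecke_surjective x
  by_cases h : cs.IsLeftDescent w i
  · exact Or.inl (cs.heckeGen_mul_toHecke_of_isLeftDescent h)
  · right
    rw [cs.heckeGen_mul_toHecke_of_not_isLeftDescent h, heckeLength_toHecke, heckeLength_toHecke,
      cs.not_isLeftDescent_iff.1 h]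
    exact Nat.lt_succ_self _

theorem mul_heckeGen_eq_or_length_lt (cs : CoxeterSystem m W) (x : ZeroHeckeMonoid m) (i : I) :
    x * heckeGen m i = x ∨ heckeLength m x < heckeLength m (x * heckeGen m i) := by
  obtain ⟨w, rfl⟩ := cs.toHecke_surjective x
  by_cases h : cs.IsRightDescent w i
  · exact Or.inl (cs.toHecke_mul_heckeGen_of_isRightDescent h)
  · right
    rw [cs.toHecke_mul_heckeGen_of_not_isRightDescent h, heckeLength_toHecke, heckeLength_toHecke,
      cs.not_isRightDescent_iff.1 h]
    exact Nat.lt_succ_self _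

end CoxeterSystem

end CoxeterToHecke

open CoxeterSystem (altList)

/-! ### Braid relations for commuting idempotents -/

section CommutingImages

variable {I N : Type*} [Monoid N] {m : CoxeterMatrix I} {f : I → N}

theorem prod_map_altList_of_commute (hidem : ∀ i, f i * f i = f i) {i j : I}
    (h : Commute (f i) (f j)) (n : ℕ) : ((altList i j (n + 2)).map f).prod = f i * f j := by
  induction n generalizing i j with
  | zero => simp [altList]
  | succ n ih =>
    rw [altList, List.map_cons, List.prod_cons, ih h.symm, h.symm.eq, ← mul_assoc, hidem]

/-- An alternating product of at least two commuting idempotents collapses to the product of the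
two, whatever its length. -/
theorem braid_of_commute (hidem : ∀ i, f i * f i = f i) {i j : I} (h : Commute (f i) (f j)) :
    ((altList i j (m i j)).map f).prod = ((altList j i (m i j)).map f).prod := by
  by_cases hij : i = j
  · rw [hij]
  have h1 := m.off_diagonal i j hij
  obtain h0 | ⟨n, hn⟩ : m i j = 0 ∨ ∃ n, m i j = n + 2 := by
    by_cases h0 : m i j = 0
    · exact Or.inl h0
    · exact Or.inr ⟨m i j - 2, by omega⟩
  · rw [h0]; rfl
  · rw [hn, prod_map_altList_of_commute hidem h, prod_map_altList_of_commute hidem h.symm, h.eq]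

end CommutingImages

/-! ### Parabolic submonoids -/

section Parabolic

variable {I : Type*} {m : CoxeterMatrix I}

open Classical in
/-- The homomorphism to `ℕ` with value `1` on the parabolic submonoid of `J` and `0` elsewhere. -/
noncomputable def parabolicIndicator (m : CoxeterMatrix I) (J : Set I) : ZeroHeckeMonoid m →* ℕ :=
  heckeLift (fun i => if i ∈ J then 1 else 0) (fun i => by split_ifs <;> rfl)
    (fun _ _ => braid_of_commute (fun i => by split_ifs <;> rfl) (Commute.all _ _))

theorem heckeGen_mem_heckeParabolic {J : Set I} {i : I} (h : i ∈ J) :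
    heckeGen m i ∈ heckeParabolic m J :=
  Submonoid.subset_closure ⟨i, h, rfl⟩

theorem heckeParabolic_mono {J K : Set I} (h : J ⊆ K) : heckeParabolic m J ≤ heckeParabolic m K :=
  Submonoid.closure_mono (Set.image_mono h)

theorem heckeParabolic_induction {J : Set I} {p : ZeroHeckeMonoid m → Prop} (one : p 1)
    (mul : ∀ i ∈ J, ∀ x, p x → p (heckeGen m i * x)) {x : ZeroHeckeMonoid m}
    (hx : x ∈ heckeParabolic m J) : p x := by
  induction hx using Submonoid.closure_induction_left with
  | one => exact one
  | mul_left y hy x _ ih =>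
    obtain ⟨i, hi, rfl⟩ := hy
    exact mul i hi x ih

theorem heckeParabolic_univ : heckeParabolic m Set.univ = ⊤ := by
  rw [heckeParabolic, Set.image_univ]
  exact PresentedMonoid.closure_range_of _

theorem heckeMonoid_induction {p : ZeroHeckeMonoid m → Prop} (one : p 1)
    (mul : ∀ i x, p x → p (heckeGen m i * x)) (x : ZeroHeckeMonoid m) : p x :=
  heckeParabolic_induction (J := Set.univ) one (fun i _ => mul i)
    (by rw [heckeParabolic_univ]; trivial)

theorem mem_heckeParabolic_iff_indicator {J : Set I} {x : ZeroHeckeMonoid m} :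
    x ∈ heckeParabolic m J ↔ parabolicIndicator m J x = 1 := by
  constructor
  · refine heckeParabolic_induction (p := fun x => parabolicIndicator m J x = 1) (map_one _) ?_
    intro i hi y hy
    rw [map_mul, hy, parabolicIndicator, heckeLift_heckeGen, if_pos hi]
  · refine heckeMonoid_induction
      (p := fun x => parabolicIndicator m J x = 1 → x ∈ heckeParabolic m J)
      (fun _ => one_mem _) ?_ x
    intro i y hy h
    rw [map_mul, mul_eq_one] at h
    refine mul_mem (heckeGen_mem_heckeParabolic ?_) (hy h.2)
    by_contra hi
    have h1 := h.1
    rw [parabolicIndicator, heckeLift_heckeGen, if_neg hi] at h1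
    exact zero_ne_one h1

/-- The indicator is multiplicative with values in ℕ, where a product is 1 only if both factors are.
-/
theorem mul_mem_heckeParabolic_iff {J : Set I} {x y : ZeroHeckeMonoid m} :
    x * y ∈ heckeParabolic m J ↔ x ∈ heckeParabolic m J ∧ y ∈ heckeParabolic m J := by
  simp only [mem_heckeParabolic_iff_indicator, map_mul, mul_eq_one]

theorem heckeGen_mem_heckeParabolic_iff {J : Set I} {i : I} :
    heckeGen m i ∈ heckeParabolic m J ↔ i ∈ J := by
  rw [mem_heckeParabolic_iff_indicator, parabolicIndicator, heckeLift_heckeGen]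
  split_ifs with h <;> simp [h]

/-- An element outside a parabolic submonoid factors at its first letter outside. -/
theorem exists_factorization_of_notMem_heckeParabolic {J : Set I} {x : ZeroHeckeMonoid m}
    (hx : x ∉ heckeParabolic m J) :
    ∃ p ∈ heckeParabolic m J, ∃ i ∉ J, ∃ q, x = p * heckeGen m i * q := by
  revert hx
  refine heckeMonoid_induction (p := fun x => x ∉ heckeParabolic m J →
    ∃ p ∈ heckeParabolic m J, ∃ i ∉ J, ∃ q, x = p * heckeGen m i * q)
    (fun h => absurd (one_mem _) h) ?_ x
  intro i y ih h
  by_cases hi : i ∈ J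
  · have hiJ := heckeGen_mem_heckeParabolic (m := m) hi
    obtain ⟨p, hp, k, hk, q, rfl⟩ := ih fun hy => h (mul_mem hiJ hy)
    exact ⟨heckeGen m i * p, mul_mem hiJ hp, k, hk, q, by simp only [mul_assoc]⟩
  · exact ⟨1, one_mem _, i, hi, y, by rw [one_mul]⟩

/-- The generators that fix `x` on the left. -/
def leftFixers (x : ZeroHeckeMonoid m) : Set I := {i | heckeGen m i * x = x}

/-- The generators that fix `x` on the right. -/
def rightFixers (x : ZeroHeckeMonoid m) : Set I := {i | x * heckeGen m i = x}

end Parabolic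

/-! ### Fixers, symbols and the shape of quiver elements -/

section LengthMonotone

variable {I W : Type*} [Group W] {m : CoxeterMatrix I}

namespace CoxeterSystem

theorem mul_eq_right_or_heckeLength_lt (cs : CoxeterSystem m W) (x y : ZeroHeckeMonoid m) :
    x * y = y ∨ heckeLength m y < heckeLength m (x * y) := by
  refine heckeMonoid_induction
    (p := fun x => x * y = y ∨ heckeLength m y < heckeLength m (x * y)) (Or.inl (one_mul y)) ?_ x
  intro i x ih
  rw [mul_assoc]
  rcases cs.heckeGen_mul_eq_or_length_lt i (x * y) with h | h
  · rwa [h]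
  · rcases ih with h' | h'
    · right; rwa [h'] at h ⊢
    · exact Or.inr (h'.trans h)

theorem mul_eq_left_or_heckeLength_lt (cs : CoxeterSystem m W) (x y : ZeroHeckeMonoid m) :
    x * y = x ∨ heckeLength m x < heckeLength m (x * y) := by
  refine heckeMonoid_induction
    (p := fun y => ∀ x, x * y = x ∨ heckeLength m x < heckeLength m (x * y))
    (fun x => Or.inl (mul_one x)) ?_ y x
  intro i y ih x
  rw [← mul_assoc]
  rcases cs.mul_heckeGen_eq_or_length_lt x i with h | h
  · rw [h]; exact ih x
  · rcases ih (x * heckeGen m i) with h' | h'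
    · right; rwa [h']
    · exact Or.inr (h.trans h')

/-- Passing from y to u y v either changes nothing or strictly increases the length. -/
theorem isJTrivialMonoid_zeroHecke (cs : CoxeterSystem m W) :
    IsJTrivialMonoid (ZeroHeckeMonoid m) := by
  have key : ∀ x y : ZeroHeckeMonoid m, GreenJLE x y → x = y ∨
      heckeLength m y < heckeLength m x := by
    rintro _ y ⟨u, v, rfl⟩
    rcases cs.mul_eq_left_or_heckeLength_lt (u * y) v with h | h
    · rw [h]; exact cs.mul_eq_right_or_heckeLength_lt u y
    · rcases cs.mul_eq_right_or_heckeLength_lt u y with h' | h'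
      · right; rwa [h'] at h ⊢
      · exact Or.inr (h'.trans h)
  intro x y hxy hyx
  rcases key x y hxy with h | h
  · exact h
  · rcases key y x hyx with h' | h'
    · exact h'.symm
    · exact absurd h h'.asymm

theorem mul_eq_self_of_isLongest (cs : CoxeterSystem m W) {J : Set I} {x y : ZeroHeckeMonoid m}
    (hx : IsLongestInParabolic m J x) (hy : y ∈ heckeParabolic m J) : x * y = x :=
  (cs.mul_eq_left_or_heckeLength_lt x y).resolve_right (hx.2 _ (mul_mem hx.1 hy)).not_gt

theorem self_mul_eq_of_isLongest (cs : CoxeterSystem m W) {J : Set I} {x y : ZeroHeckeMonoid m}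
    (hx : IsLongestInParabolic m J x) (hy : y ∈ heckeParabolic m J) : y * x = x :=
  (cs.mul_eq_right_or_heckeLength_lt y x).resolve_right (hx.2 _ (mul_mem hy hx.1)).not_gt

/-- The elements that fix `x` on the left form a parabolic submonoid. -/
theorem mul_eq_right_iff_mem (cs : CoxeterSystem m W) {x y : ZeroHeckeMonoid m} :
    y * x = x ↔ y ∈ heckeParabolic m (leftFixers x) := by
  constructor
  · refine heckeMonoid_induction
      (p := fun y => y * x = x → y ∈ heckeParabolic m (leftFixers x)) (fun _ => one_mem _) ?_ y
    intro i y ih h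
    rw [mul_assoc] at h
    -- Otherwise y x is longer than x, and the further factor π_i could not bring the length back.
    have hy : y * x = x := by
      refine (cs.mul_eq_right_or_heckeLength_lt y x).resolve_right fun h1 => ?_
      rcases cs.mul_eq_right_or_heckeLength_lt (heckeGen m i) (y * x) with h2 | h2
      · rw [← h2, h] at h1; exact h1.false
      · rw [h] at h2; exact h1.asymm h2
    rw [hy] at h
    exact mul_mem (heckeGen_mem_heckeParabolic h) (ih hy)
  · refine heckeParabolic_induction (p := fun y => y * x = x) (one_mul x) ?_
    intro i hi y hy
    rw [mul_assoc, hy]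
    exact hi

/-- The elements that fix `x` on the right form a parabolic submonoid. -/
theorem mul_eq_left_iff_mem (cs : CoxeterSystem m W) {x y : ZeroHeckeMonoid m} :
    x * y = x ↔ y ∈ heckeParabolic m (rightFixers x) := by
  constructor
  · refine heckeMonoid_induction
      (p := fun y => x * y = x → y ∈ heckeParabolic m (rightFixers x)) (fun _ => one_mem _) ?_ y
    intro i y ih h
    rw [← mul_assoc] at h
    have hy : x * heckeGen m i = x := by
      refine (cs.mul_eq_left_or_heckeLength_lt x _).resolve_right fun h1 => ?_
      rcases cs.mul_eq_left_or_heckeLength_lt (x * heckeGen m i) y with h2 | h2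
      · rw [← h2, h] at h1; exact h1.false
      · rw [h] at h2; exact h1.asymm h2
    rw [hy] at h
    exact mul_mem (heckeGen_mem_heckeParabolic hy) (ih h)
  · refine heckeParabolic_induction (p := fun y => x * y = x) (mul_one x) ?_
    intro i hi y hy
    rw [← mul_assoc, show x * heckeGen m i = x from hi, hy]

variable [Finite W]

/-- A longest element absorbs its parabolic submonoid on both sides, so two of them both equal their
product. -/
theorem existsUnique_isLongestInParabolic (cs : CoxeterSystem m W) (J : Set I) :
    ∃! x, IsLongestInParabolic m J x := by
  have := cs.finite_zeroHeckeMonoid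
  obtain ⟨x, hx, hmax⟩ := Set.exists_max_image (heckeParabolic m J : Set (ZeroHeckeMonoid m))
    (heckeLength m) (Set.toFinite _) ⟨1, one_mem _⟩
  have hxl : IsLongestInParabolic m J x := ⟨hx, hmax⟩
  refine ⟨x, hxl, fun y hy => ?_⟩
  rw [← cs.mul_eq_self_of_isLongest hy hx, cs.self_mul_eq_of_isLongest hxl hy.1]

theorem isLongestInParabolic_heckePi (cs : CoxeterSystem m W) (J : Set I) :
    IsLongestInParabolic m J (heckePi m J) :=
  Classical.epsilon_spec (cs.existsUnique_isLongestInParabolic J).exists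

theorem heckePi_mem (cs : CoxeterSystem m W) (J : Set I) : heckePi m J ∈ heckeParabolic m J :=
  (cs.isLongestInParabolic_heckePi J).1

theorem heckePi_mul (cs : CoxeterSystem m W) {J : Set I} {y : ZeroHeckeMonoid m}
    (hy : y ∈ heckeParabolic m J) : heckePi m J * y = heckePi m J :=
  cs.mul_eq_self_of_isLongest (cs.isLongestInParabolic_heckePi J) hy

theorem mul_heckePi (cs : CoxeterSystem m W) {J : Set I} {y : ZeroHeckeMonoid m}
    (hy : y ∈ heckeParabolic m J) : y * heckePi m J = heckePi m J :=
  cs.self_mul_eq_of_isLongest (cs.isLongestInParabolic_heckePi J) hy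

theorem heckePi_mul_eq_iff (cs : CoxeterSystem m W) {J : Set I} {y : ZeroHeckeMonoid m} :
    heckePi m J * y = heckePi m J ↔ y ∈ heckeParabolic m J :=
  ⟨fun h => (mul_mem_heckeParabolic_iff.1 (h ▸ cs.heckePi_mem J)).2, cs.heckePi_mul⟩

theorem mul_heckePi_eq_iff (cs : CoxeterSystem m W) {J : Set I} {y : ZeroHeckeMonoid m} :
    y * heckePi m J = heckePi m J ↔ y ∈ heckeParabolic m J :=
  ⟨fun h => (mul_mem_heckeParabolic_iff.1 (h ▸ cs.heckePi_mem J)).1, cs.mul_heckePi⟩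

/-- Any g fixing x lies in the parabolic submonoid of the fixers, hence is absorbed by its longest
element, which is thus below g. -/
theorem lfix_eq_heckePi (cs : CoxeterSystem m W) (x : ZeroHeckeMonoid m) :
    lfix x = heckePi m (leftFixers x) := by
  have := cs.finite_zeroHeckeMonoid
  have hJ := cs.isJTrivialMonoid_zeroHecke
  refine (existsUnique_isLeftSymbol hJ x).unique (isLeftSymbol_lfix hJ x)
    ⟨cs.heckePi_mul (cs.heckePi_mem _), cs.mul_eq_right_iff_mem.2 (cs.heckePi_mem _), ?_⟩
  intro g _ hg
  exact ⟨1, heckePi m (leftFixers x), by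
    rw [one_mul, cs.mul_heckePi (cs.mul_eq_right_iff_mem.1 hg)]⟩

theorem rfix_eq_heckePi (cs : CoxeterSystem m W) (x : ZeroHeckeMonoid m) :
    rfix x = heckePi m (rightFixers x) := by
  have := cs.finite_zeroHeckeMonoid
  have hJ := cs.isJTrivialMonoid_zeroHecke
  refine (existsUnique_isRightSymbol hJ x).unique (isRightSymbol_rfix hJ x)
    ⟨cs.heckePi_mul (cs.heckePi_mem _), cs.mul_eq_left_iff_mem.2 (cs.heckePi_mem _), ?_⟩
  intro g _ hg
  exact ⟨heckePi m (rightFixers x), 1, by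
    rw [mul_one, cs.heckePi_mul (cs.mul_eq_left_iff_mem.1 hg)]⟩

theorem isNontrivialFactorization_iff (cs : CoxeterSystem m W) {x u v : ZeroHeckeMonoid m} :
    IsNontrivialFactorization x u v ↔ x = u * v ∧ u ∉ heckeParabolic m (leftFixers x) ∧
      v ∉ heckeParabolic m (rightFixers x) := by
  rw [IsNontrivialFactorization, cs.lfix_eq_heckePi, cs.rfix_eq_heckePi, ne_eq, ne_eq,
    cs.heckePi_mul_eq_iff, cs.mul_heckePi_eq_iff]

theorem eq_heckePi_mul_heckePi_of_mem_quiverElements (cs : CoxeterSystem m W)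
    {x : ZeroHeckeMonoid m} (hx : x ∈ quiverElements (ZeroHeckeMonoid m)) :
    x = heckePi m (leftFixers x) * heckePi m (rightFixers x) := by
  obtain ⟨hirr, hidem⟩ := hx
  simp only [IsCIrreducible, cs.isNontrivialFactorization_iff] at hirr
  have hJx := cs.mul_eq_right_iff_mem.2 (cs.heckePi_mem (leftFixers x))
  have hxK := cs.mul_eq_left_iff_mem.2 (cs.heckePi_mem (rightFixers x))
  set J := leftFixers x
  set K := rightFixers x
  have hxJ : x ∉ heckeParabolic m J := fun h => hidem (cs.mul_eq_right_iff_mem.2 h)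
  obtain ⟨p, hp, i, hi, q, hpq⟩ := exists_factorization_of_notMem_heckeParabolic hxJ
  have hq : q ∈ heckeParabolic m K := by
    by_contra hq
    exact hirr _ _ ⟨hpq, fun h => hi (heckeGen_mem_heckeParabolic_iff.1
      (mul_mem_heckeParabolic_iff.1 h).2), hq⟩
  have hxi : x = heckePi m J * heckeGen m i * heckePi m K := by
    calc x = heckePi m J * x * heckePi m K := by rw [hJx, hxK]
      _ = heckePi m J * p * heckeGen m i * (q * heckePi m K) := by
        rw [hpq]; simp only [mul_assoc]
      _ = _ := by rw [cs.heckePi_mul hp, cs.mul_heckePi hq]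
  -- If i were outside K, writing π_i as π_i π_i and cutting between the copies would be a
  -- non-trivial factorization.
  have hiK : i ∈ K := by
    by_contra hiK
    refine hirr (heckePi m J * heckeGen m i) (heckeGen m i * heckePi m K) ⟨?_, ?_, ?_⟩
    · calc x = heckePi m J * (heckeGen m i * heckeGen m i) * heckePi m K := by
            rw [heckeGen_mul_self, ← hxi]
        _ = _ := by simp only [mul_assoc]
    · exact fun h => hi (heckeGen_mem_heckeParabolic_iff.1 (mul_mem_heckeParabolic_iff.1 h).2)
    · exact fun h => hiK (heckeGen_mem_heckeParabolic_iff.1 (mul_mem_heckeParabolic_iff.1 h).1)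
  rwa [mul_assoc, cs.mul_heckePi (heckeGen_mem_heckeParabolic hiK)] at hxi

theorem isQuiverPair_fixers (cs : CoxeterSystem m W)
    {x : ZeroHeckeMonoid m} (hx : x ∈ quiverElements (ZeroHeckeMonoid m)) :
    IsQuiverPair m (leftFixers x) (rightFixers x) := by
  have hprod := cs.eq_heckePi_mul_heckePi_of_mem_quiverElements hx
  obtain ⟨hirr, hidem⟩ := hx
  simp only [IsCIrreducible, cs.isNontrivialFactorization_iff] at hirr
  set J := leftFixers x
  set K := rightFixers x
  have hidemPi : ∀ L, IsIdempotentElem (heckePi m L) := fun L => cs.heckePi_mul (cs.heckePi_mem L)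
  refine ⟨fun h => hidem ?_, fun h => hidem ?_, ?_⟩
  · rw [hprod, cs.mul_heckePi (heckeParabolic_mono h (cs.heckePi_mem J))]
    exact hidemPi K
  · rw [hprod, cs.heckePi_mul (heckeParabolic_mono h (cs.heckePi_mem K))]
    exact hidemPi J
  · rintro j ⟨hjJ, hjK⟩ k ⟨hkK, hkJ⟩ hcomm
    -- Extract π_j from π_J and π_k from π_K, swap them and cut between.
    refine hirr (heckePi m J * heckeGen m k) (heckeGen m j * heckePi m K) ⟨?_, ?_, ?_⟩
    · calc x = heckePi m J * heckeGen m j * (heckeGen m k * heckePi m K) := by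
            rw [cs.heckePi_mul (heckeGen_mem_heckeParabolic hjJ),
              cs.mul_heckePi (heckeGen_mem_heckeParabolic hkK), ← hprod]
        _ = heckePi m J * (heckeGen m j * heckeGen m k) * heckePi m K := by
            simp only [mul_assoc]
        _ = _ := by rw [hcomm.eq]; simp only [mul_assoc]
    · exact fun h => hkJ (heckeGen_mem_heckeParabolic_iff.1 (mul_mem_heckeParabolic_iff.1 h).2)
    · exact fun h => hjK (heckeGen_mem_heckeParabolic_iff.1 (mul_mem_heckeParabolic_iff.1 h).1)

end CoxeterSystem

end LengthMonotone

/-! ### Detecting non-commuting generators by lowering maps of {0, 1, 2} -/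

section CatalanQuotient

variable {I : Type*} {m : CoxeterMatrix I}

instance : DecidableEq (Function.End (Fin 3)) := inferInstanceAs (DecidableEq (Fin 3 → Fin 3))

/-- The map of `{0, 1, 2}` that lowers `1`. -/
def lowerOne : Function.End (Fin 3) := ![0, 0, 2]

/-- The map of `{0, 1, 2}` that lowers `2`. -/
def lowerTwo : Function.End (Fin 3) := ![0, 1, 1]

theorem lowerOne_apply_of_le (b : Fin 3) (hb : b ≤ 1) : lowerOne b = (0 : Fin 3) :=
  (by decide : ∀ b : Fin 3, b ≤ 1 → (![0, 0, 2] : Fin 3 → Fin 3) b = 0) b hb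

/-- From three letters on, an alternating product is the constant map 0, so the braid relations of
all lengths m ≥ 3 hold at once. -/
theorem prod_map_altList_lower {f : I → Function.End (Fin 3)} {i j : I}
    (h : f i = lowerTwo ∧ f j = lowerOne ∨ f i = lowerOne ∧ f j = lowerTwo) (n : ℕ) :
    ((altList i j (n + 3)).map f).prod = lowerOne * lowerTwo := by
  induction n generalizing i j with
  | zero => rcases h with ⟨hi, hj⟩ | ⟨hi, hj⟩ <;> simp [altList, hi, hj] <;> decide
  | succ n ih =>
    rw [altList, List.map_cons, List.prod_cons, ih (by tauto)]
    rcases h with ⟨hi, hj⟩ | ⟨hi, hj⟩ <;> rw [hi] <;> decide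

theorem commute_of_coxeterMatrix_eq_two {i j : I} (h : m i j = 2) :
    Commute (heckeGen m i) (heckeGen m j) := by
  have := heckeGen_braid (m := m) i j
  rw [h] at this
  simpa [altList, Commute, SemiconjBy] using this

open Classical in
/-- The values on the generators of the homomorphism from the 0-Hecke monoid to the maps of
`{0, 1, 2}` that sees the generators `j` and `k`. -/
noncomputable def catalanGen (j k i : I) : Function.End (Fin 3) :=
  if i = j then lowerTwo else if i = k then lowerOne else 1

theorem catalanGen_left (j k : I) : catalanGen j k j = lowerTwo := if_pos rfl

theorem catalanGen_right {j k : I} (h : j ≠ k) : catalanGen j k k = lowerOne := by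
  rw [catalanGen, if_neg h.symm, if_pos rfl]

theorem catalanGen_of_ne {j k i : I} (hj : i ≠ j) (hk : i ≠ k) : catalanGen j k i = 1 := by
  rw [catalanGen, if_neg hj, if_neg hk]

theorem catalanGen_mul_self (j k i : I) :
    catalanGen j k i * catalanGen j k i = catalanGen j k i := by
  unfold catalanGen
  split_ifs <;> decide

theorem catalanGen_braid {j k : I} (h : ¬ Commute (heckeGen m j) (heckeGen m k)) (i i' : I) :
    ((altList i i' (m i i')).map (catalanGen j k)).prod =
      ((altList i' i (m i i')).map (catalanGen j k)).prod := by
  have hjk : j ≠ k := by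
    rintro rfl
    exact h (Commute.refl _)
  have hm2 : m j k ≠ 2 := fun h2 => h (commute_of_coxeterMatrix_eq_two h2)
  have hm1 := m.off_diagonal j k hjk
  by_cases hc : Commute (catalanGen j k i) (catalanGen j k i')
  · exact braid_of_commute (catalanGen_mul_self j k) hc
  have hpair : i = j ∧ i' = k ∨ i = k ∧ i' = j := by
    by_contra hn
    apply hc
    by_cases h1 : i = j
    · by_cases h2 : i' = j
      · rw [h1, h2]
      · rw [catalanGen_of_ne h2 (by tauto)]
        exact Commute.one_right _
    · by_cases h2 : i = k
      · by_cases h3 : i' = k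
        · rw [h2, h3]
        · rw [catalanGen_of_ne (i := i') (by tauto) h3]
          exact Commute.one_right _
      · rw [catalanGen_of_ne h1 h2]
        exact Commute.one_left _
  have hmi : m i i' = m j k := by
    rcases hpair with ⟨rfl, rfl⟩ | ⟨rfl, rfl⟩
    · rfl
    · exact m.symmetric _ _
  have hval : catalanGen j k i = lowerTwo ∧ catalanGen j k i' = lowerOne ∨
      catalanGen j k i = lowerOne ∧ catalanGen j k i' = lowerTwo := by
    rcases hpair with ⟨rfl, rfl⟩ | ⟨rfl, rfl⟩
    · exact Or.inl ⟨catalanGen_left _ _, catalanGen_right hjk⟩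
    · exact Or.inr ⟨catalanGen_right hjk, catalanGen_left _ _⟩
  rw [hmi]
  obtain h0 | ⟨n, hn⟩ : m j k = 0 ∨ ∃ n, m j k = n + 3 := by
    by_cases h0 : m j k = 0
    · exact Or.inl h0
    · exact Or.inr ⟨m j k - 3, by omega⟩
  · rw [h0]; rfl
  · rw [hn, prod_map_altList_lower hval, prod_map_altList_lower (by tauto)]

/-- A homomorphism to the maps of `{0, 1, 2}` that detects the product of two generators that do
not commute. -/
noncomputable def catalanHom {j k : I} (h : ¬ Commute (heckeGen m j) (heckeGen m k)) :
    ZeroHeckeMonoid m →* Function.End (Fin 3) :=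
  heckeLift (catalanGen j k) (catalanGen_mul_self j k) (catalanGen_braid h)

variable {j k : I} (h : ¬ Commute (heckeGen m j) (heckeGen m k))

theorem catalanHom_left : catalanHom h (heckeGen m j) = lowerTwo := by
  rw [catalanHom, heckeLift_heckeGen, catalanGen_left]

theorem catalanHom_right : catalanHom h (heckeGen m k) = lowerOne := by
  rw [catalanHom, heckeLift_heckeGen, catalanGen_right]
  rintro rfl
  exact h (Commute.refl _)

theorem catalanHom_of_ne {i : I} (hj : i ≠ j) (hk : i ≠ k) : catalanHom h (heckeGen m i) = 1 := by
  rw [catalanHom, heckeLift_heckeGen, catalanGen_of_ne hj hk]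

theorem catalanHom_apply_le (x : ZeroHeckeMonoid m) (a : Fin 3) : catalanHom h x a ≤ a := by
  refine heckeMonoid_induction (p := fun x => catalanHom h x a ≤ a) (by rw [map_one]; rfl) ?_ x
  intro i y hy
  rw [map_mul]
  refine le_trans ?_ hy
  change catalanHom h (heckeGen m i) (catalanHom h y a) ≤ catalanHom h y a
  generalize catalanHom h y a = b
  rw [catalanHom, heckeLift_heckeGen, catalanGen]
  revert b
  split_ifs <;> decide

theorem catalanHom_apply_one_of_factor (p q : ZeroHeckeMonoid m) :
    catalanHom h (p * heckeGen m k * q) 1 = 0 := by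
  rw [map_mul, map_mul, catalanHom_right]
  change catalanHom h p (lowerOne (catalanHom h q 1)) = 0
  have hq := catalanHom_apply_le h q 1
  rw [lowerOne_apply_of_le _ hq]
  exact Fin.le_zero_iff.1 (catalanHom_apply_le h p 0)

theorem catalanHom_apply_two_of_factor (p q : ZeroHeckeMonoid m) :
    catalanHom h (p * heckeGen m j * q) 2 ≤ 1 := by
  rw [map_mul, map_mul, catalanHom_left]
  change catalanHom h p (lowerTwo (catalanHom h q 2)) ≤ 1
  refine (catalanHom_apply_le h p _).trans ?_
  generalize catalanHom h q 2 = b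
  revert b
  decide

theorem catalanHom_eq_of_mem_left {J : Set I} (hk : k ∉ J) {x : ZeroHeckeMonoid m}
    (hx : x ∈ heckeParabolic m J) : catalanHom h x = 1 ∨ catalanHom h x = lowerTwo := by
  refine heckeParabolic_induction
    (p := fun x => catalanHom h x = 1 ∨ catalanHom h x = lowerTwo) (Or.inl (map_one _)) ?_ hx
  intro i hi y hy
  rw [map_mul]
  by_cases hij : i = j
  · rw [hij, catalanHom_left]
    rcases hy with hy | hy <;> rw [hy] <;> right <;> decide
  · rwa [catalanHom_of_ne h hij (fun e => hk (e ▸ hi)), one_mul]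

theorem catalanHom_eq_of_mem_right {K : Set I} (hj : j ∉ K) {x : ZeroHeckeMonoid m}
    (hx : x ∈ heckeParabolic m K) : catalanHom h x = 1 ∨ catalanHom h x = lowerOne := by
  refine heckeParabolic_induction
    (p := fun x => catalanHom h x = 1 ∨ catalanHom h x = lowerOne) (Or.inl (map_one _)) ?_ hx
  intro i hi y hy
  rw [map_mul]
  by_cases hik : i = k
  · rw [hik, catalanHom_right]
    rcases hy with hy | hy <;> rw [hy] <;> right <;> decide
  · rwa [catalanHom_of_ne h (fun e => hj (e ▸ hi)) hik, one_mul]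

namespace CoxeterSystem

variable {W : Type*} [Group W] [Finite W]

/-- As k ∉ J, the image of π_J is 1 or `lowerTwo`, and absorbing π_j leaves only `lowerTwo`;
symmetrically for π_K. The product sends 2 to 1. -/
theorem catalanHom_heckePi_mul_heckePi (cs : CoxeterSystem m W) {J K : Set I} (hj : j ∈ J \ K)
    (hk : k ∈ K \ J) : catalanHom h (heckePi m J * heckePi m K) = lowerTwo * lowerOne := by
  have h1 := catalanHom_eq_of_mem_left h hk.2 (cs.heckePi_mem J)
  have h2 := catalanHom_eq_of_mem_right h hj.2 (cs.heckePi_mem K)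
  have e1 := congrArg (catalanHom h) (cs.heckePi_mul (heckeGen_mem_heckeParabolic (m := m) hj.1))
  have e2 := congrArg (catalanHom h) (cs.heckePi_mul (heckeGen_mem_heckeParabolic (m := m) hk.1))
  rw [map_mul, catalanHom_left] at e1
  rw [map_mul, catalanHom_right] at e2
  rw [map_mul, ← e1, ← e2]
  rcases h1 with h1 | h1 <;> rcases h2 with h2 | h2 <;> rw [h1, h2] <;> decide

theorem heckePi_mul_heckePi_mem (cs : CoxeterSystem m W) (J K : Set I) :
    heckePi m J * heckePi m K ∈ heckeParabolic m (J ∪ K) :=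
  mul_mem (heckeParabolic_mono Set.subset_union_left (cs.heckePi_mem J))
    (heckeParabolic_mono Set.subset_union_right (cs.heckePi_mem K))

theorem leftFixers_heckePi_mul_heckePi (cs : CoxeterSystem m W) {J K : Set I}
    (hJK : IsQuiverPair m J K) : leftFixers (heckePi m J * heckePi m K) = J := by
  obtain ⟨hnJK, -, hcomm⟩ := hJK
  ext i
  constructor
  · intro hi
    by_contra hiJ
    have hfix : heckeGen m i * (heckePi m J * heckePi m K) = heckePi m J * heckePi m K := hi
    -- Only letters of J ∪ K can occur. A fixing i in K∖J would then make `lowerOne` fix the image,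
    -- but it moves the value 1 at 2 to 0.
    have hiK : i ∈ K := by
      have := cs.heckePi_mul_heckePi_mem J K
      rw [← hfix, mul_mem_heckeParabolic_iff, heckeGen_mem_heckeParabolic_iff] at this
      exact this.1.resolve_left hiJ
    obtain ⟨j, hj⟩ := Set.not_subset.1 hnJK
    have h := hcomm j hj i ⟨hiK, hiJ⟩
    have := congrArg (catalanHom h) hfix
    rw [map_mul, cs.catalanHom_heckePi_mul_heckePi h hj ⟨hiK, hiJ⟩, catalanHom_right] at this
    revert this
    decide
  · intro hi
    change heckeGen m i * (heckePi m J * heckePi m K) = heckePi m J * heckePi m K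
    rw [← mul_assoc, cs.mul_heckePi (heckeGen_mem_heckeParabolic hi)]

theorem rightFixers_heckePi_mul_heckePi (cs : CoxeterSystem m W) {J K : Set I}
    (hJK : IsQuiverPair m J K) : rightFixers (heckePi m J * heckePi m K) = K := by
  obtain ⟨-, hnKJ, hcomm⟩ := hJK
  ext i
  constructor
  · intro hi
    by_contra hiK
    have hfix : heckePi m J * heckePi m K * heckeGen m i = heckePi m J * heckePi m K := hi
    have hiJ : i ∈ J := by
      have := cs.heckePi_mul_heckePi_mem J K
      rw [← hfix, mul_mem_heckeParabolic_iff, heckeGen_mem_heckeParabolic_iff] at this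
      exact this.2.resolve_right hiK
    obtain ⟨k, hk⟩ := Set.not_subset.1 hnKJ
    have h := hcomm i ⟨hiJ, hiK⟩ k hk
    have := congrArg (catalanHom h) hfix
    rw [map_mul, cs.catalanHom_heckePi_mul_heckePi h ⟨hiJ, hiK⟩ hk, catalanHom_left] at this
    revert this
    decide
  · intro hi
    change heckePi m J * heckePi m K * heckeGen m i = heckePi m J * heckePi m K
    rw [mul_assoc, cs.heckePi_mul (heckeGen_mem_heckeParabolic hi)]

theorem heckePi_mul_heckePi_mem_quiverElements (cs : CoxeterSystem m W) {J K : Set I}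
    (hJK : IsQuiverPair m J K) :
    heckePi m J * heckePi m K ∈ quiverElements (ZeroHeckeMonoid m) := by
  have hL := cs.leftFixers_heckePi_mul_heckePi hJK
  have hR := cs.rightFixers_heckePi_mul_heckePi hJK
  have hmem := cs.heckePi_mul_heckePi_mem J K
  obtain ⟨hnJK, hnKJ, hcomm⟩ := hJK
  constructor
  · intro u v huv
    rw [cs.isNontrivialFactorization_iff, hL, hR] at huv
    obtain ⟨he, hu, hv⟩ := huv
    rw [he, mul_mem_heckeParabolic_iff] at hmem
    obtain ⟨p, -, k, hkJ, q, rfl⟩ := exists_factorization_of_notMem_heckeParabolic hu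
    obtain ⟨p', -, j, hjK, q', rfl⟩ := exists_factorization_of_notMem_heckeParabolic hv
    simp only [mul_mem_heckeParabolic_iff, heckeGen_mem_heckeParabolic_iff] at hmem
    have hk : k ∈ K \ J := ⟨hmem.1.1.2.resolve_left hkJ, hkJ⟩
    have hj : j ∈ J \ K := ⟨hmem.2.1.2.resolve_right hjK, hjK⟩
    have h := hcomm j hj k hk
    have hφ := congrArg (catalanHom h) he
    rw [cs.catalanHom_heckePi_mul_heckePi h hj hk, map_mul] at hφ
    -- Evaluate at 2: v contains π_j and brings 2 to at most 1, then u contains π_k and brings that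
    -- to 0, while π_J π_K gives 1.
    have h2 := congrFun hφ 2
    change (1 : Fin 3) = catalanHom h _ (catalanHom h _ 2) at h2
    have hle := catalanHom_apply_two_of_factor h p' q'
    have h1 := catalanHom_apply_one_of_factor h p q
    have h0 := catalanHom_apply_le h (p * heckeGen m k * q) 0
    generalize catalanHom h (p' * heckeGen m j * q') 2 = b at h2 hle
    generalize catalanHom h (p * heckeGen m k * q) = T at h2 h1 h0
    obtain rfl | rfl := (by decide : ∀ b : Fin 3, b ≤ 1 → b = 0 ∨ b = 1) b hle
    · rw [Fin.le_zero_iff.1 h0] at h2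
      exact absurd h2 (by decide)
    · rw [h1] at h2
      exact absurd h2 (by decide)
  · intro hidem
    obtain ⟨j, hj⟩ := Set.not_subset.1 hnJK
    obtain ⟨k, hk⟩ := Set.not_subset.1 hnKJ
    have h := hcomm j hj k hk
    have := congrArg (catalanHom h) hidem.eq
    rw [map_mul, cs.catalanHom_heckePi_mul_heckePi h hj hk] at this
    revert this
    decide

end CoxeterSystem

end CatalanQuotient

theorem mainTheorem7 {I W : Type*} [Finite I] [Group W] [Finite W]
    (m : CoxeterMatrix I) (_cs : CoxeterSystem m W) :
    -- the notions below are well defined: the monoid is finite and `J`-trivial,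
    -- and every parabolic submonoid has a unique longest element
    Finite (ZeroHeckeMonoid m) ∧ IsJTrivialMonoid (ZeroHeckeMonoid m) ∧
    (∀ J : Set I, ∃! x, IsLongestInParabolic m J x) ∧
    -- the quiver elements
    (∀ x : ZeroHeckeMonoid m, x ∈ quiverElements (ZeroHeckeMonoid m) ↔
      ∃ J K : Set I, IsQuiverPair m J K ∧ x = heckePi m J * heckePi m K) ∧
    -- the labelling: the arrow of `π_J π_K` goes from `π_J` to `π_K`,
    -- and different pairs label different arrows
    (∀ J K : Set I, IsQuiverPair m J K →
      lfix (heckePi m J * heckePi m K) = heckePi m J ∧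
      rfix (heckePi m J * heckePi m K) = heckePi m K) ∧
    Set.InjOn (fun p : Set I × Set I => heckePi m p.1 * heckePi m p.2)
      {p | IsQuiverPair m p.1 p.2} := by
  refine ⟨_cs.finite_zeroHeckeMonoid, _cs.isJTrivialMonoid_zeroHecke,
    _cs.existsUnique_isLongestInParabolic, fun x => ⟨fun hx => ?_, ?_⟩, fun J K hJK => ⟨?_, ?_⟩, ?_⟩
  · exact ⟨_, _, _cs.isQuiverPair_fixers hx, _cs.eq_heckePi_mul_heckePi_of_mem_quiverElements hx⟩
  · rintro ⟨J, K, hJK, rfl⟩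
    exact _cs.heckePi_mul_heckePi_mem_quiverElements hJK
  · rw [_cs.lfix_eq_heckePi, _cs.leftFixers_heckePi_mul_heckePi hJK]
  · rw [_cs.rfix_eq_heckePi, _cs.rightFixers_heckePi_mul_heckePi hJK]
  · rintro ⟨J, K⟩ hJK ⟨J', K'⟩ hJK' he
    have he' : heckePi m J * heckePi m K = heckePi m J' * heckePi m K' := he
    refine Prod.ext ?_ ?_
    · rw [← _cs.leftFixers_heckePi_mul_heckePi hJK, he', _cs.leftFixers_heckePi_mul_heckePi hJK']
    · rw [← _cs.rightFixers_heckePi_mul_heckePi hJK, he',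
        _cs.rightFixers_heckePi_mul_heckePi hJK']
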